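/- Let $(E,\mathcal B,\mu)$ be a standard measurable space with a finite measure $\mu$, and let $\{P_t\}_{t>0}$ be a symmetric, strongly continuous, contractive, sub-Markovian semigroup on $L^2(\mu)$ with generator $(L,D(L))$. Let $F_{1,2}=D(\sqrt{-L})=D((1-L)^{1/2})$ be the image of $L^2(\mu)$ under $V_1=(1-L)^{-1/2}=\Gamma(\tfrac12)^{-1}\int_0^\infty t^{-1/2}e^{-t}P_t\,dt$, and let $$\mathcal E(u,v)=\langle\sqrt{-L}\,u,\sqrt{-L}\,v\rangle_{L^2(\mu)}=\langle (1-L)^{1/2}u,(1-L)^{1/2}v\rangle_{L^2(\mu)}-\langle u,v\rangle_{L^2(\mu)},\qquad u,v\in F_{1,2},$$ be the associated Dirichlet form. Assume that it is transient: there is a bounded $\mu$-integrable function $g$, strictly positive $\mu$-a.e., with $\int_E|u|g\,d\mu\le\mathcal E(u,u)^{1/2}$ for all $u\in F_{1,2}$. Let $\mathcal F_e$ be the completion of $F_{1,2}$ with respect to the norm $\mathcal E(\cdot,\cdot)^{1/2}$, and let $\mathcal F_e^*$ be its dual space. An element $\ell\in\mathcal F_e^*$ is said to lie in $L^1(\mu)\cap\mathcal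 F_e^*$, and is then identified with $v\in L^1(\mu)$, if $\ell(u)=\int_E uv\,d\mu$ for all $u\in F_{1,2}\cap L^\infty(\mu)$ (such a $v$ is unique); it is said to lie in $L^2(\mu)\cap\mathcal F_e^*$ if there is $v\in L^2(\mu)$ with $\ell(u)=\int_E uv\,d\mu$ for all $u\in F_{1,2}$. Let $\psi:\mathbb R\to[0,\infty)$ be convex and lower semicontinuous with $\psi(0)=0$ and $\lim_{|r|\to\infty}\psi(r)/|r|=+\infty$. Define $\varphi:\mathcal F_e^*\to[0,\infty]$ by $\varphi(v)=\int_E\psi(v(x))\,\mu(dx)$ if $v\in L^1(\mu)\cap\mathcal F_e^*$, and $\varphi(v)=+\infty$ otherwise. Assume that $\|P_t\|_{1\to2}<\infty$ for all $t>0$, where $\|P_t\|_{1\to2}$ is the norm of $P_t$ as an operator from $L^1(\mu)$ to $L^2(\mu)$. Then for every $v\in\mathcal F_e^*$ with $\varphi(v)<\infty$ there is a sequence $(v_n)_{n\in\mathbb N}$ in $L^2(\mu)\cap\mathcal F_e^*$ such that $v_n\rightharpoonup v$ weakly in $\mathcal F_e^*$ and $\lim_{n\to\infty}\varphi(v_n)=\varphi(v)$.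 -/

import Mathlib

open MeasureTheory Filter Topology Set
open scoped ENNReal

noncomputable section

namespace DirichletSVI

variable {E : Type*} [MeasurableSpace E]

/-- A symmetric, strongly continuous, contractive, sub-Markovian semigroup `(P_t)_{t > 0}` on the
real Hilbert space `L²(μ)`. Only the values at times `t > 0` carry any meaning. -/
structure SubMarkovSemigroup (μ : Measure E) where
  P : ℝ → Lp ℝ 2 μ →L[ℝ] Lp ℝ 2 μ
  semigroup : ∀ s t : ℝ, 0 < s → 0 < t → ∀ f, P (s + t) f = P s (P t f)
  strongly_continuous : ∀ f, Tendsto (fun t => P t f) (𝓝[>] 0) (𝓝 f)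
  contraction : ∀ t : ℝ, 0 < t → ∀ f, ‖P t f‖ ≤ ‖f‖
  symmetric : ∀ t : ℝ, 0 < t → ∀ f g, inner ℝ (P t f) g = inner ℝ f (P t g)
  sub_markov : ∀ t : ℝ, 0 < t → ∀ f : Lp ℝ 2 μ, (∀ᵐ x ∂μ, 0 ≤ f x ∧ f x ≤ 1) →
    ∀ᵐ x ∂μ, 0 ≤ P t f x ∧ P t f x ≤ 1

namespace SubMarkovSemigroup

variable {μ : Measure E} (S : SubMarkovSemigroup μ)

theorem norm_sub_le {s t : ℝ} (hs : 0 < s) (hst : s < t) (f : Lp ℝ 2 μ) :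
    ‖S.P t f - S.P s f‖ ≤ ‖S.P (t - s) f - f‖ := by
  have h : S.P t f = S.P s (S.P (t - s) f) := by
    rw [← S.semigroup s (t - s) hs (by linarith)]; congr 2; ring
  rw [h, ← map_sub]
  exact S.contraction s hs _

theorem continuousOn (f : Lp ℝ 2 μ) : ContinuousOn (fun t => S.P t f) (Ioi 0) := by
  rw [Metric.continuousOn_iff]
  intro t ht ε hε
  have h := (Metric.tendsto_nhdsWithin_nhds.1 (S.strongly_continuous f)) ε hε
  obtain ⟨δ, hδ, h⟩ := h
  refine ⟨δ, hδ, fun s hs hd => ?_⟩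
  rcases lt_trichotomy s t with hlt | heq | hgt
  · have := h (x := t - s) (by simpa using hlt) (by
      rw [Real.dist_eq] at hd ⊢; rwa [sub_zero, abs_sub_comm])
    rw [dist_eq_norm] at this ⊢
    rw [norm_sub_rev]
    exact (S.norm_sub_le hs hlt f).trans_lt this
  · simpa [heq] using hε
  · have := h (x := s - t) (by simpa using hgt) (by
      rw [Real.dist_eq] at hd ⊢; rwa [sub_zero])
    rw [dist_eq_norm] at this ⊢
    exact (S.norm_sub_le ht hgt f).trans_lt this

/-- The weight `t ^ (r / 2 - 1) * e ^ (-t)` of the Gamma-transform, for `r = 1`. -/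
def weight (t : ℝ) : ℝ := Real.exp (-t) * t ^ ((1 : ℝ) / 2 - 1)

theorem weight_integrable : IntegrableOn weight (Ioi 0) :=
  Real.GammaIntegral_convergent (by norm_num)

theorem weight_pos {t : ℝ} (ht : 0 < t) : 0 < weight t := by
  unfold weight; positivity

theorem integral_weight : ∫ t in Ioi (0 : ℝ), weight t = Real.Gamma (1 / 2) :=
  (Real.Gamma_eq_integral (by norm_num)).symm

theorem integrable_transform (f : Lp ℝ 2 μ) :
    IntegrableOn (fun t => weight t • S.P t f) (Ioi 0) := by
  refine Integrable.mono' (weight_integrable.mul_const ‖f‖) ?_ ?_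
  · exact weight_integrable.aestronglyMeasurable.smul
      ((S.continuousOn f).aestronglyMeasurable measurableSet_Ioi)
  · refine (ae_restrict_iff' measurableSet_Ioi).2 (ae_of_all _ fun t ht => ?_)
    rw [norm_smul, Real.norm_of_nonneg (weight_pos ht).le]
    exact mul_le_mul_of_nonneg_left (S.contraction t ht f) (weight_pos ht).le

/-- The Gamma-transform `V₁ w = Γ(1/2)⁻¹ ∫₀^∞ t^(-1/2) e^(-t) P_t w dt` (a Bochner integral in
`L²(μ)`), that is, `V₁ = (1 - L)^(-1/2)` for the generator `L` of the semigroup. -/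
def V₁ : Lp ℝ 2 μ →ₗ[ℝ] Lp ℝ 2 μ where
  toFun w := (Real.Gamma (1 / 2))⁻¹ • ∫ t in Ioi (0 : ℝ), weight t • S.P t w
  map_add' f g := by
    simp only [map_add, smul_add]
    rw [integral_add (S.integrable_transform f) (S.integrable_transform g), smul_add]
  map_smul' c f := by
    simp only [map_smul, RingHom.id_apply]
    simp_rw [smul_comm _ c]
    rw [integral_smul, smul_comm]

theorem norm_V₁_le (w : Lp ℝ 2 μ) : ‖S.V₁ w‖ ≤ ‖w‖ := by
  have hG : 0 < Real.Gamma (1 / 2) := Real.Gamma_pos_of_pos (by norm_num)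
  change ‖(Real.Gamma (1 / 2))⁻¹ • ∫ t in Ioi (0 : ℝ), weight t • S.P t w‖ ≤ ‖w‖
  rw [norm_smul, Real.norm_of_nonneg (inv_nonneg.2 hG.le), inv_mul_le_iff₀ hG]
  rw [← integral_weight, ← integral_mul_const]
  refine norm_integral_le_of_norm_le (weight_integrable.mul_const _) ?_
  refine (ae_restrict_iff' measurableSet_Ioi).2 (ae_of_all _ fun t ht => ?_)
  rw [norm_smul, Real.norm_of_nonneg (weight_pos ht).le]
  exact mul_le_mul_of_nonneg_left (S.contraction t ht w) (weight_pos ht).le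

theorem inner_P_self {t : ℝ} (ht : 0 < t) (w : Lp ℝ 2 μ) :
    inner ℝ w (S.P t w) = ‖S.P (t / 2) w‖ ^ 2 := by
  have h : S.P t w = S.P (t / 2) (S.P (t / 2) w) := by
    rw [← S.semigroup _ _ (half_pos ht) (half_pos ht), add_halves]
  rw [h, ← S.symmetric _ (half_pos ht), real_inner_self_eq_norm_sq]

theorem V₁_injective : Function.Injective S.V₁ := by
  rw [injective_iff_map_eq_zero]
  intro w hw
  have hG : 0 < Real.Gamma (1 / 2) := Real.Gamma_pos_of_pos (by norm_num)
  have h0 : ∫ t in Ioi (0 : ℝ), weight t • S.P t w = 0 := by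
    have : (Real.Gamma (1 / 2))⁻¹ • ∫ t in Ioi (0 : ℝ), weight t • S.P t w = 0 := hw
    exact (smul_eq_zero.1 this).resolve_left (inv_ne_zero hG.ne')
  have hi : IntegrableOn (fun t => inner ℝ w (weight t • S.P t w)) (Ioi 0) :=
    (S.integrable_transform w).const_inner w
  have h1 : ∫ t in Ioi (0 : ℝ), inner ℝ w (weight t • S.P t w) = 0 := by
    rw [integral_inner (S.integrable_transform w), h0, inner_zero_right]
  have hnn : ∀ t ∈ Ioi (0 : ℝ), (0 : ℝ) ≤ inner ℝ w (weight t • S.P t w) := fun t ht => by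
    rw [inner_smul_right, S.inner_P_self ht]
    exact mul_nonneg (weight_pos ht).le (sq_nonneg _)
  have h2 := (setIntegral_eq_zero_iff_of_nonneg_ae
    ((ae_restrict_iff' measurableSet_Ioi).2 (ae_of_all _ hnn)) hi).1 h1
  have h3 : ∀ᵐ t ∂(volume.restrict (Ioi (0 : ℝ))), S.P (t / 2) w = 0 := by
    filter_upwards [h2, ae_restrict_mem measurableSet_Ioi] with t h ht
    have h' : inner ℝ w (weight t • S.P t w) = (0 : ℝ) := h
    rw [inner_smul_right, S.inner_P_self ht] at h'
    simpa [(weight_pos ht).ne'] using h'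
  have h4 : ∃ᶠ t in 𝓝[>] (0 : ℝ), S.P t w = 0 := by
    rw [frequently_iff]
    intro U hU
    obtain ⟨δ, hδ, hU⟩ := mem_nhdsGT_iff_exists_Ioo_subset.1 hU
    have hδ : 0 < δ := hδ
    by_contra! hcon
    have hz : volume (Ioo (0 : ℝ) δ) = 0 := by
      rw [ae_restrict_iff' measurableSet_Ioi, ae_iff] at h3
      refine measure_mono_null (fun t ht => ?_) h3
      simp only [mem_ofPred_eq, Classical.not_imp]
      exact ⟨ht.1, hcon _ (hU ⟨half_pos ht.1, by linarith [ht.1, ht.2]⟩)⟩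
    simp at hz
    linarith
  by_contra hne
  have := (S.strongly_continuous w).eventually_ne hne
  exact h4 this

/-- `F_{1,2} = V₁(L²(μ)) = D((1 - L)^(1/2)) = D(√(-L))`, the domain of the Dirichlet form. It is a
synonym of a subspace of `L²(μ)`, because below it carries the norm `ℰ(u, u)^(1/2)`. -/
def F₁₂ : Type _ := LinearMap.range S.V₁

instance : AddCommGroup S.F₁₂ := inferInstanceAs (AddCommGroup (LinearMap.range S.V₁))

instance : Module ℝ S.F₁₂ := inferInstanceAs (Module ℝ (LinearMap.range S.V₁))

/-- The inclusion `F_{1,2} ⊆ L²(μ)`. -/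
def toL2 : S.F₁₂ →ₗ[ℝ] Lp ℝ 2 μ := (LinearMap.range S.V₁).subtype

/-- `(1 - L)^(1/2) : F_{1,2} → L²(μ)`, the inverse of `V₁`. -/
def sqrtOneSubL : S.F₁₂ ≃ₗ[ℝ] Lp ℝ 2 μ := (LinearEquiv.ofInjective S.V₁ S.V₁_injective).symm

theorem V₁_sqrtOneSubL (u : S.F₁₂) : S.V₁ (S.sqrtOneSubL u) = S.toL2 u :=
  congrArg Subtype.val
    ((LinearEquiv.ofInjective S.V₁ S.V₁_injective).apply_symm_apply u)

/-- The Dirichlet form `ℰ(u, v) = ⟨√(-L) u, √(-L) v⟩₂`, expressed through the inner product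
`⟨(1 - L)^(1/2) u, (1 - L)^(1/2) v⟩₂ = ℰ(u, v) + ⟨u, v⟩₂` of `F_{1,2}`. -/
def energy (u v : S.F₁₂) : ℝ :=
  inner ℝ (S.sqrtOneSubL u) (S.sqrtOneSubL v) - inner ℝ (S.toL2 u) (S.toL2 v)

/-- `ℰ` is a nonnegative symmetric bilinear form. -/
@[reducible] def energyCore : PreInnerProductSpace.Core ℝ S.F₁₂ where
  inner := S.energy
  conj_inner_symm u v := by simp [energy, real_inner_comm]
  re_inner_nonneg u := by
    have h := S.norm_V₁_le (S.sqrtOneSubL u)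
    rw [V₁_sqrtOneSubL] at h
    simp only [energy, real_inner_self_eq_norm_sq, RCLike.re_to_real]
    nlinarith [norm_nonneg (S.toL2 u)]
  add_left u v w := by simp only [energy, map_add, inner_add_left]; ring
  smul_left u v r := by
    simp only [energy, map_smul, inner_smul_left, conj_trivial]; ring

/-- The (semi)norm of `F_{1,2}` used for the completion is `‖u‖ = ℰ(u, u)^(1/2)`. -/
instance : SeminormedAddCommGroup S.F₁₂ :=
  InnerProductSpace.Core.toSeminormedAddCommGroup (c := S.energyCore)

instance : InnerProductSpace ℝ S.F₁₂ := InnerProductSpace.ofCore S.energyCore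

/-- The extended Dirichlet space `F_e`: the completion of `F_{1,2}` for `ℰ(u, u)^(1/2)`. -/
abbrev Fe : Type _ := UniformSpace.Completion S.F₁₂

/-- The dual space `F_e^*`. -/
abbrev FeDual : Type _ := StrongDual ℝ S.Fe

/-- Transience: there is a bounded `μ`-integrable `g`, strictly positive `μ`-a.e., such that
`∫ |u| g dμ ≤ ℰ(u, u)^(1/2)` for all `u ∈ F_{1,2}`. -/
def Transient : Prop :=
  ∃ g : E → ℝ, (∃ C, ∀ x, |g x| ≤ C) ∧ Integrable g μ ∧ (∀ᵐ x ∂μ, 0 < g x) ∧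
    ∀ u : S.F₁₂, ∫ x, |S.toL2 u x| * g x ∂μ ≤ √(S.energy u u)

/-- The norm `‖P_t‖_{1 → 2} ∈ [0, ∞]` of `P_t` as an operator from `L¹(μ)` to `L²(μ)`. Since `μ` is
finite in the application, the functions of `L²(μ)` form a dense subspace of `L¹(μ)`. -/
def norm12 (t : ℝ) : ℝ≥0∞ :=
  ⨆ (f : Lp ℝ 2 μ) (_ : eLpNorm f 1 μ ≤ 1), eLpNorm (S.P t f) 2 μ

/-- `ℓ ∈ F_e^*` is (the functional identified with) the element `v` of `L¹(μ) ∩ F_e^*`: it is the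
continuous extension to `F_e` of `u ↦ ∫ u v dμ`, `u ∈ F_{1,2} ∩ L^∞(μ)`. The existence of such an `ℓ`
says in particular that `∫ u v dμ ≤ C ‖u‖_{F_e}` for all these `u`. -/
def RepresentsL1 (ℓ : S.FeDual) (v : Lp ℝ 1 μ) : Prop :=
  ∀ u : S.F₁₂, MemLp (S.toL2 u) ∞ μ → ℓ (u : S.Fe) = ∫ x, S.toL2 u x * v x ∂μ

/-- `ℓ ∈ F_e^*` is (the functional identified with) the element `v` of `L²(μ) ∩ F_e^*`: it is the
continuous extension to `F_e` of `u ↦ ∫ u v dμ`, `u ∈ F_e ∩ L²(μ) = F_{1,2}`. -/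
def RepresentsL2 (ℓ : S.FeDual) (v : Lp ℝ 2 μ) : Prop :=
  ∀ u : S.F₁₂, ℓ (u : S.Fe) = ∫ x, S.toL2 u x * v x ∂μ

/-- `L²(μ) ∩ F_e^*` as a subset of `F_e^*`. -/
def L2capFeDual : Set S.FeDual := {ℓ | ∃ v : Lp ℝ 2 μ, S.RepresentsL2 ℓ v}

/-- The energy functional `φ : F_e^* → [0, ∞]`: `φ(v) = ∫ ψ(v) dμ` for `v ∈ L¹(μ) ∩ F_e^*`, and
`φ = ∞` elsewhere. A functional is represented by at most one `v ∈ L¹(μ)`, so that the infimum is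
over one element or over the empty set (then it is `∞`). -/
def phi (ψ : ℝ → ℝ) (ℓ : S.FeDual) : ℝ≥0∞ :=
  ⨅ (v : Lp ℝ 1 μ) (_ : S.RepresentsL1 ℓ v), ∫⁻ x, ENNReal.ofReal (ψ (v x)) ∂μ

end SubMarkovSemigroup

end DirichletSVI

end

/-! ### Truncation, order properties and Jensen's inequality for the semigroup -/

namespace DirichletSVI

variable {E : Type*} [MeasurableSpace E] {μ : Measure E}

/-! The approximants are `v ∘ P_t` along times `t → 0`. Three facts make them work.

On `F₁₂` the semigroup is symmetric, contractive and strongly continuous for the energy seminorm. It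
extends to `Fe`, and by Riesz duality `v ∘ P_t → v` even in norm (`exists_dual_smoothing`).

If `v` is represented by `f ∈ L¹`, then `v ∘ P_t` is represented by `P_t f`, which lies in `L²`
because `P_t` maps `L¹` boundedly to `L²` (`exists_isSmoothing`, `RepresentsL1.representsL2`). The
same smoothing shows that representatives are unique, so `phi` really is the integral of `ψ`.

Jensen's inequality for sub-Markovian operators gives `∫ ψ(P_t f) ≤ ∫ ψ(f)`, where `ψ 0 = 0`
compensates for `P_t 1 ≤ 1` (`lintegral_convex_P_le`). Since `P_t f → f` in `L¹`, Fatou along an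
a.e. convergent subsequence gives the opposite bound. -/

theorem ae_abs_le_of_memLp_top {f : E → ℝ} (hf : MemLp f ∞ μ) :
    ∃ M : ℝ, 0 ≤ M ∧ ∀ᵐ x ∂μ, |f x| ≤ M := by
  refine ⟨(eLpNorm f ∞ μ).toReal, ENNReal.toReal_nonneg, ?_⟩
  filter_upwards [ae_le_eLpNormEssSup (f := f) (μ := μ)] with x hx
  rw [← eLpNorm_exponent_top] at hx
  have := (ENNReal.toReal_le_toReal enorm_ne_top hf.2.ne).2 hx
  simpa using this

theorem memLp_top_of_ae_abs_le {f : E → ℝ} (hf : AEStronglyMeasurable f μ) {M : ℝ}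
    (h : ∀ᵐ x ∂μ, |f x| ≤ M) : MemLp f ∞ μ :=
  memLp_top_of_bound hf M h

/-- Bounded truncations of an `L^p` function. -/
theorem exists_bounded_approx [IsFiniteMeasure μ] {p : ℝ≥0∞} (w : Lp ℝ p μ) :
    ∃ f : ℕ → Lp ℝ 2 μ, (∀ k, MemLp (f k) ∞ μ) ∧ (∀ k, ∀ᵐ x ∂μ, f k x = 0 ∨ f k x = w x) ∧
      Tendsto (fun k => eLpNorm (⇑(f k) - ⇑w) p μ) atTop (𝓝 0) := by
  have hsm := Lp.stronglyMeasurable w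
  have key : ∀ k : ℕ, ∃ f : Lp ℝ 2 μ, MemLp f ∞ μ ∧ (∀ᵐ x ∂μ, f x = 0 ∨ f x = w x) ∧
      eLpNorm (⇑f - ⇑w) p μ ≤ ENNReal.ofReal (1 / ((k : ℝ) + 1)) := by
    intro k
    -- Uniform integrability of the single function `w` supplies the truncation level.
    obtain ⟨M, hM⟩ := (Lp.memLp w).eLpNorm_indicator_norm_ge_le hsm
      (ε := 1 / ((k : ℝ) + 1)) (by positivity)
    set s : Set E := {x | M ≤ ↑‖w x‖₊}
    have hs : MeasurableSet s := measurableSet_le measurable_const hsm.measurable.nnnorm.coe_nnreal_real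
    have hmeas : AEStronglyMeasurable (sᶜ.indicator w) μ :=
      (hsm.indicator hs.compl).aestronglyMeasurable
    have hb : ∀ x, ‖sᶜ.indicator w x‖ ≤ |M| := by
      intro x
      by_cases hx : x ∈ s
      · simp [hx]
      · rw [indicator_of_mem (by simpa using hx)]
        have : ¬ M ≤ ‖w x‖ := hx
        exact (le_of_lt (not_le.1 this)).trans (le_abs_self M)
    have htop : MemLp (sᶜ.indicator w) ∞ μ := memLp_top_of_bound hmeas |M| (ae_of_all _ hb)
    have h2 : MemLp (sᶜ.indicator w) 2 μ := htop.mono_exponent le_top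
    have hco := h2.coeFn_toLp
    refine ⟨h2.toLp _, htop.ae_eq hco.symm, ?_, ?_⟩
    · filter_upwards [hco] with x hx
      rw [hx]
      by_cases hxs : x ∈ s <;> simp [hxs]
    · refine le_trans (le_of_eq ?_) hM
      rw [← eLpNorm_neg (f := s.indicator w)]
      refine eLpNorm_congr_ae ?_
      filter_upwards [hco] with x hx
      simp only [Pi.sub_apply, Pi.neg_apply, hx]
      by_cases hxs : x ∈ s <;> simp [hxs]
  choose f h1 h2 h3 using key
  refine ⟨f, h1, h2, tendsto_of_tendsto_of_tendsto_of_le_of_le tendsto_const_nhds ?_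
    (fun _ => zero_le) h3⟩
  rw [← ENNReal.ofReal_zero]
  exact ENNReal.tendsto_ofReal tendsto_one_div_add_atTop_nhds_zero_nat

theorem L2_inner_eq_integral (f g : Lp ℝ 2 μ) : inner ℝ f g = ∫ x, f x * g x ∂μ := by
  rw [L2.inner_def]
  simp [mul_comm]

namespace SubMarkovSemigroup

variable (S : SubMarkovSemigroup μ)

theorem P_nonneg {t : ℝ} (ht : 0 < t) {f : Lp ℝ 2 μ} (h0 : ∀ᵐ x ∂μ, 0 ≤ f x) {M : ℝ}
    (hM : ∀ᵐ x ∂μ, f x ≤ M) : ∀ᵐ x ∂μ, 0 ≤ S.P t f x := by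
  have hN : 0 < max M 1 := lt_max_of_lt_right one_pos
  have h := S.sub_markov t ht ((max M 1)⁻¹ • f) (by
    filter_upwards [h0, hM, Lp.coeFn_smul (max M 1)⁻¹ f] with x h0 hM hx
    rw [hx, Pi.smul_apply, smul_eq_mul]
    exact ⟨by positivity, (inv_mul_le_one₀ hN).2 (hM.trans (le_max_left _ _))⟩)
  rw [map_smul] at h
  filter_upwards [h, Lp.coeFn_smul (max M 1)⁻¹ (S.P t f)] with x h hx
  rw [hx, Pi.smul_apply, smul_eq_mul] at h
  exact nonneg_of_mul_nonneg_right h.1 (inv_pos.2 hN)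

variable [IsFiniteMeasure μ]

theorem P_one {t : ℝ} (ht : 0 < t) :
    ∀ᵐ x ∂μ, 0 ≤ S.P t (Lp.const 2 μ (1 : ℝ)) x ∧ S.P t (Lp.const 2 μ (1 : ℝ)) x ≤ 1 := by
  refine S.sub_markov t ht _ ?_
  filter_upwards [Lp.coeFn_const (p := 2) (μ := μ) (1 : ℝ)] with x hx
  rw [hx]; simp

/-- An affine minorant `a f + b` with `b ≤ 0` is preserved by the semigroup. -/
theorem affine_le_P {t : ℝ} (ht : 0 < t) {f g : Lp ℝ 2 μ} (hf : MemLp f ∞ μ) (hg : MemLp g ∞ μ)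
    {a b : ℝ} (hb : b ≤ 0) (h : ∀ᵐ x ∂μ, a * f x + b ≤ g x) :
    ∀ᵐ x ∂μ, a * S.P t f x + b ≤ S.P t g x := by
  obtain ⟨M, -, hM⟩ := ae_abs_le_of_memLp_top hf
  obtain ⟨N, -, hN⟩ := ae_abs_le_of_memLp_top hg
  have e : ∀ f' g' o : Lp ℝ 2 μ, ∀ᵐ x ∂μ,
      (g' - a • f' - b • o : Lp ℝ 2 μ) x = g' x - a * f' x - b * o x := by
    intro f' g' o
    filter_upwards [Lp.coeFn_sub (g' - a • f') (b • o), Lp.coeFn_sub g' (a • f'),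
      Lp.coeFn_smul a f', Lp.coeFn_smul b o] with x h1 h2 h3 h4
    rw [h1, Pi.sub_apply, h2, Pi.sub_apply, h3, h4]; simp
  have hc := Lp.coeFn_const (p := 2) (μ := μ) (1 : ℝ)
  have hp := S.P_nonneg ht (f := g - a • f - b • Lp.const 2 μ (1 : ℝ)) (M := N + |a| * M + |b|)
    (by
      filter_upwards [e f g (Lp.const 2 μ (1 : ℝ)), hc, h] with x h1 h2 h3
      rw [h1, h2, Function.const_apply]; linarith)
    (by
      filter_upwards [e f g (Lp.const 2 μ (1 : ℝ)), hc, hM, hN] with x h1 h2 h3 h4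
      rw [h1, h2, Function.const_apply]
      have h5 : |a * f x| ≤ |a| * M := by
        rw [abs_mul]; exact mul_le_mul_of_nonneg_left h3 (abs_nonneg _)
      linarith [le_abs_self (g x), neg_abs_le (a * f x), neg_abs_le b])
  rw [map_sub, map_sub, map_smul, map_smul] at hp
  filter_upwards [hp, e (S.P t f) (S.P t g) (S.P t (Lp.const 2 μ (1 : ℝ))), S.P_one ht]
    with x h1 h2 h3
  rw [h2] at h1
  -- Positivity gives the bound with `b * P_t 1` in place of `b`; since `b ≤ 0` and `P_t 1 ≤ 1`,
  -- that is at least `b`.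
  nlinarith [h3.1, h3.2]

theorem P_abs_le {t : ℝ} (ht : 0 < t) {f : Lp ℝ 2 μ} {M : ℝ} (hM : 0 ≤ M)
    (hf : ∀ᵐ x ∂μ, |f x| ≤ M) : ∀ᵐ x ∂μ, |S.P t f x| ≤ M := by
  have hb : MemLp f ∞ μ := memLp_top_of_ae_abs_le (Lp.aestronglyMeasurable f) hf
  have h0 : MemLp (0 : Lp ℝ 2 μ) ∞ μ := MemLp.zero.ae_eq (Lp.coeFn_zero ℝ 2 μ).symm
  have hz := Lp.coeFn_zero ℝ 2 μ
  have h1 := S.affine_le_P ht hb h0 (a := 1) (b := -M) (by linarith) (by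
    filter_upwards [hf, hz] with x hx h
    rw [h, Pi.zero_apply]; linarith [le_abs_self (f x)])
  have h2 := S.affine_le_P ht hb h0 (a := -1) (b := -M) (by linarith) (by
    filter_upwards [hf, hz] with x hx h
    rw [h, Pi.zero_apply]; linarith [neg_abs_le (f x)])
  rw [map_zero] at h1 h2
  filter_upwards [h1, h2, hz] with x h1 h2 h
  rw [h, Pi.zero_apply] at h1 h2
  exact abs_le.2 ⟨by linarith, by linarith⟩

theorem P_memLp_top {t : ℝ} (ht : 0 < t) {f : Lp ℝ 2 μ} (hf : MemLp f ∞ μ) :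
    MemLp (S.P t f) ∞ μ := by
  obtain ⟨M, hM0, hM⟩ := ae_abs_le_of_memLp_top hf
  exact memLp_top_of_ae_abs_le (Lp.aestronglyMeasurable _) (S.P_abs_le ht hM0 hM)

/-- By symmetry the left side is `⟨g, P_t 1⟩`, and `P_t 1 ≤ 1`. -/
theorem integral_P_le {t : ℝ} (ht : 0 < t) {g : Lp ℝ 2 μ} (hg : ∀ᵐ x ∂μ, 0 ≤ g x) :
    ∫ x, S.P t g x ∂μ ≤ ∫ x, g x ∂μ := by
  have hc := Lp.coeFn_const (p := 2) (μ := μ) (1 : ℝ)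
  have e : ∫ x, S.P t g x ∂μ = inner ℝ (S.P t g) (Lp.const 2 μ (1 : ℝ)) := by
    rw [L2_inner_eq_integral]
    refine integral_congr_ae ?_
    filter_upwards [hc] with x hx
    rw [hx]; simp
  rw [e, S.symmetric t ht, L2_inner_eq_integral]
  refine integral_mono_ae (MemLp.integrable_mul (p := 2) (q := 2) (Lp.memLp _) (Lp.memLp _))
    ((Lp.memLp g).integrable (by norm_num)) ?_
  filter_upwards [hg, S.P_one ht] with x h1 h2
  exact mul_le_of_le_one_right h1 h2.2

/-- Jensen: `ψ` is a supremum of countably many affine functions, whose intercepts are at most `ψ 0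
= 0`, so `affine_le_P` applies to each. Countability allows a common null set, whence `ψ (P_t f) ≤
P_t (ψ f)` a.e.; then integrate. -/
theorem lintegral_convex_P_le {ψ : ℝ → ℝ} (hψ_nonneg : ∀ r, 0 ≤ ψ r)
    (hψ_convex : ConvexOn ℝ univ ψ) (hψ_zero : ψ 0 = 0) {t : ℝ} (ht : 0 < t) {f : Lp ℝ 2 μ}
    (hf : MemLp f ∞ μ) :
    ∫⁻ x, ENNReal.ofReal (ψ (S.P t f x)) ∂μ ≤ ∫⁻ x, ENNReal.ofReal (ψ (f x)) ∂μ := by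
  have hcont : Continuous ψ := by
    rw [← continuousOn_univ]; exact hψ_convex.continuousOn isOpen_univ
  obtain ⟨M, -, hM⟩ := ae_abs_le_of_memLp_top hf
  obtain ⟨C, hC⟩ := (isCompact_Icc (a := -M) (b := M)).exists_bound_of_continuousOn
    hcont.continuousOn
  have hgtop : MemLp (fun x => ψ (f x)) ∞ μ := by
    refine memLp_top_of_bound (hcont.comp_aestronglyMeasurable (Lp.aestronglyMeasurable f)) C ?_
    filter_upwards [hM] with x hx
    exact hC _ (abs_le.1 hx)
  have hg2 : MemLp (fun x => ψ (f x)) 2 μ := hgtop.mono_exponent le_top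
  set g : Lp ℝ 2 μ := hg2.toLp _
  have hg : ∀ᵐ x ∂μ, g x = ψ (f x) := hg2.coeFn_toLp
  obtain ⟨l, c, hle, hsup⟩ := hψ_convex.real_univ_sSup_of_nat_affine_eq hcont.lowerSemicontinuous
  have hl : ∀ i r, l i r = l i 1 * r := fun i r => by
    have := (l i).map_smul r 1
    simpa [mul_comm] using this
  have hle' : ∀ i r, l i 1 * r + c i ≤ ψ r := fun i r => by
    rw [← hl]; exact hle i r
  have hjensen : ∀ᵐ x ∂μ, ψ (S.P t f x) ≤ S.P t g x := by
    have : ∀ i, ∀ᵐ x ∂μ, l i 1 * S.P t f x + c i ≤ S.P t g x := fun i => by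
      refine S.affine_le_P ht hf (hgtop.ae_eq hg2.coeFn_toLp.symm) ?_ ?_
      · simpa [hψ_zero] using hle' i 0
      · filter_upwards [hg] with x hx
        rw [hx]; exact hle' i _
    filter_upwards [ae_all_iff.2 this] with x hx
    have e := congrFun hsup (S.P t f x)
    rw [← e, iSup_apply]
    refine ciSup_le fun i => ?_
    change l i (S.P t f x) + c i ≤ _
    rw [hl]; exact hx i
  have hg0 : ∀ᵐ x ∂μ, 0 ≤ g x := by filter_upwards [hg] with x hx; rw [hx]; exact hψ_nonneg _
  calc ∫⁻ x, ENNReal.ofReal (ψ (S.P t f x)) ∂μ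
      ≤ ∫⁻ x, ENNReal.ofReal (S.P t g x) ∂μ :=
        lintegral_mono_ae (hjensen.mono fun x hx => ENNReal.ofReal_le_ofReal hx)
    _ = ENNReal.ofReal (∫ x, S.P t g x ∂μ) := by
        rw [ofReal_integral_eq_lintegral_ofReal ((Lp.memLp _).integrable (by norm_num))
          (hjensen.mono fun x hx => (hψ_nonneg _).trans hx)]
    _ ≤ ENNReal.ofReal (∫ x, g x ∂μ) := ENNReal.ofReal_le_ofReal (S.integral_P_le ht hg0)
    _ = ∫⁻ x, ENNReal.ofReal (g x) ∂μ :=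
        ofReal_integral_eq_lintegral_ofReal ((Lp.memLp _).integrable (by norm_num)) hg0
    _ = ∫⁻ x, ENNReal.ofReal (ψ (f x)) ∂μ :=
        lintegral_congr_ae (hg.mono fun x hx => by simp only [hx])

theorem eLpNorm_one_P_le {t : ℝ} (ht : 0 < t) {f : Lp ℝ 2 μ} (hf : MemLp f ∞ μ) :
    eLpNorm (S.P t f) 1 μ ≤ eLpNorm f 1 μ := by
  have h := S.lintegral_convex_P_le (ψ := fun r => |r|) (fun r => abs_nonneg r)
    (convexOn_univ_norm (E := ℝ)) (by simp) ht hf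
  simpa [eLpNorm_one_eq_lintegral_enorm, Real.enorm_eq_ofReal_abs] using h

end SubMarkovSemigroup

end DirichletSVI

/-! ### The semigroup on `F₁₂`, on `Fe` and on the dual -/

namespace DirichletSVI

namespace SubMarkovSemigroup

variable {E : Type*} [MeasurableSpace E] {μ : Measure E} (S : SubMarkovSemigroup μ)

theorem V₁_apply (w : Lp ℝ 2 μ) :
    S.V₁ w = (Real.Gamma (1 / 2))⁻¹ • ∫ t in Ioi (0 : ℝ), weight t • S.P t w := rfl

theorem inner_V₁_right (f w : Lp ℝ 2 μ) :
    inner ℝ f (S.V₁ w) =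
      (Real.Gamma (1 / 2))⁻¹ * ∫ t in Ioi (0 : ℝ), weight t * inner ℝ f (S.P t w) := by
  rw [V₁_apply, inner_smul_right, ← integral_inner (S.integrable_transform w)]
  simp_rw [inner_smul_right]

theorem V₁_symmetric (f g : Lp ℝ 2 μ) : inner ℝ (S.V₁ f) g = inner ℝ f (S.V₁ g) := by
  rw [real_inner_comm, inner_V₁_right, inner_V₁_right]
  congr 1
  refine setIntegral_congr_fun measurableSet_Ioi fun t ht => ?_
  rw [← S.symmetric t ht, real_inner_comm]

theorem P_V₁ {s : ℝ} (hs : 0 < s) (w : Lp ℝ 2 μ) : S.P s (S.V₁ w) = S.V₁ (S.P s w) := by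
  rw [V₁_apply, V₁_apply, map_smul, ← ContinuousLinearMap.integral_comp_comm _
    (S.integrable_transform w)]
  congr 1
  refine setIntegral_congr_fun measurableSet_Ioi fun t ht => ?_
  rw [map_smul, ← S.semigroup s t hs ht, ← S.semigroup t s ht hs, add_comm]

/-- The Bochner integral in `L²` has no pointwise meaning, so the bound is tested against
indicators; the weight has total mass `Γ(1/2)`. -/
theorem V₁_le [IsFiniteMeasure μ] {f : Lp ℝ 2 μ} {M : ℝ} (hM : 0 ≤ M)
    (hf : ∀ᵐ x ∂μ, |f x| ≤ M) : ∀ᵐ x ∂μ, S.V₁ f x ≤ M := by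
  have hG : 0 < Real.Gamma (1 / 2) := Real.Gamma_pos_of_pos (by norm_num)
  refine ae_le_of_forall_setIntegral_le (g := fun _ => M)
    ((Lp.memLp (S.V₁ f)).integrable (by norm_num)) (integrable_const M) fun s hs hμs => ?_
  have hbound : ∀ t ∈ Ioi (0 : ℝ),
      weight t * inner ℝ (indicatorConstLp 2 hs hμs.ne (1 : ℝ)) (S.P t f) ≤
        weight t * (μ.real s * M) := fun t ht => by
    refine mul_le_mul_of_nonneg_left ?_ (weight_pos ht).le
    rw [L2.inner_indicatorConstLp_one hs hμs.ne]
    have := setIntegral_mono_ae (μ := μ) (s := s) (f := S.P t f) (g := fun _ => M)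
      (((Lp.memLp (S.P t f)).integrable (by norm_num)).integrableOn)
      (integrable_const M).integrableOn
      ((S.P_abs_le ht hM hf).mono fun x hx => (le_abs_self _).trans hx)
    simpa using this
  rw [← L2.inner_indicatorConstLp_one (𝕜 := ℝ) hs hμs.ne, inner_V₁_right, setIntegral_const,
    inv_mul_le_iff₀ hG, smul_eq_mul, ← integral_weight, ← integral_mul_const]
  refine setIntegral_mono_on ?_ (weight_integrable.mul_const _) measurableSet_Ioi hbound
  have := (S.integrable_transform f).const_inner (𝕜 := ℝ) (indicatorConstLp 2 hs hμs.ne (1 : ℝ))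
  simpa only [inner_smul_right, IntegrableOn] using this

theorem V₁_memLp_top [IsFiniteMeasure μ] {f : Lp ℝ 2 μ} (hf : MemLp f ∞ μ) :
    MemLp (S.V₁ f) ∞ μ := by
  obtain ⟨M, hM0, hM⟩ := ae_abs_le_of_memLp_top hf
  have h1 := S.V₁_le hM0 hM
  have h2 := S.V₁_le (f := -f) hM0 (by
    filter_upwards [hM, Lp.coeFn_neg f] with x hx h
    rwa [h, Pi.neg_apply, abs_neg])
  rw [map_neg] at h2
  refine memLp_top_of_ae_abs_le (Lp.aestronglyMeasurable _) (M := M) ?_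
  filter_upwards [h1, h2, Lp.coeFn_neg (S.V₁ f)] with x h1 h2 h
  rw [h, Pi.neg_apply] at h2
  exact abs_le.2 ⟨by linarith, h1⟩

/-- The semigroup on `F_{1,2}`, transported by `(1 - L)^(1/2)`. -/
noncomputable def semigroupF₁₂ (t : ℝ) : S.F₁₂ →ₗ[ℝ] S.F₁₂ :=
  S.sqrtOneSubL.symm.toLinearMap ∘ₗ (S.P t).toLinearMap ∘ₗ S.sqrtOneSubL.toLinearMap

@[simp]
theorem sqrtOneSubL_semigroupF₁₂ (t : ℝ) (u : S.F₁₂) :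
    S.sqrtOneSubL (S.semigroupF₁₂ t u) = S.P t (S.sqrtOneSubL u) := by
  simp [semigroupF₁₂]

/-- Because `P_t` commutes with `V₁`, the transported semigroup is just the restriction of `P_t`. -/
theorem toL2_semigroupF₁₂ {t : ℝ} (ht : 0 < t) (u : S.F₁₂) :
    S.toL2 (S.semigroupF₁₂ t u) = S.P t (S.toL2 u) := by
  rw [← V₁_sqrtOneSubL, sqrtOneSubL_semigroupF₁₂, ← V₁_sqrtOneSubL, P_V₁ _ ht]

theorem toL2_sqrtOneSubL_symm (w : Lp ℝ 2 μ) : S.toL2 (S.sqrtOneSubL.symm w) = S.V₁ w := by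
  rw [← V₁_sqrtOneSubL, LinearEquiv.apply_symm_apply]

theorem inner_F₁₂ (u v : S.F₁₂) : inner ℝ u v =
    inner ℝ (S.sqrtOneSubL u) (S.sqrtOneSubL v) - inner ℝ (S.toL2 u) (S.toL2 v) := rfl

theorem norm_F₁₂_le (u : S.F₁₂) : ‖u‖ ≤ ‖S.sqrtOneSubL u‖ := by
  refine le_of_sq_le_sq ?_ (norm_nonneg _)
  rw [← real_inner_self_eq_norm_sq, inner_F₁₂, real_inner_self_eq_norm_sq,
    real_inner_self_eq_norm_sq]
  linarith [sq_nonneg ‖S.toL2 u‖]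

theorem semigroupF₁₂_symmetric {t : ℝ} (ht : 0 < t) (u v : S.F₁₂) :
    inner ℝ (S.semigroupF₁₂ t u) v = inner ℝ u (S.semigroupF₁₂ t v) := by
  simp only [inner_F₁₂, sqrtOneSubL_semigroupF₁₂, S.toL2_semigroupF₁₂ ht, S.symmetric t ht]

theorem semigroupF₁₂_add {s t : ℝ} (hs : 0 < s) (ht : 0 < t) (u : S.F₁₂) :
    S.semigroupF₁₂ (s + t) u = S.semigroupF₁₂ s (S.semigroupF₁₂ t u) :=
  S.sqrtOneSubL.injective (by simp [S.semigroup s t hs ht])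

/-- A bounded sequence with `a k ^ 2 ≤ a (k + 1) * c` starts below `c`. -/
theorem le_of_bounded_of_sq_le {a : ℕ → ℝ} {c C : ℝ} (hc : 0 ≤ c) (hC : ∀ k, a k ≤ C)
    (h : ∀ k, a k ^ 2 ≤ a (k + 1) * c) : a 0 ≤ c := by
  by_contra! hlt
  -- If `a 0 > c`, each increment is at least `a 0 - c`, so the sequence grows linearly, against
  -- boundedness.
  have key : ∀ k : ℕ, a 0 + k * (a 0 - c) ≤ a k := by
    intro k
    induction k with
    | zero => simp
    | succ k ih =>
      have h1 : 0 ≤ (k : ℝ) * (a 0 - c) := mul_nonneg (Nat.cast_nonneg k) (by linarith)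
      rcases hc.eq_or_lt with rfl | hc
      · have := h k
        nlinarith
      · push_cast
        have h2 : a k * (a k - c) ≤ (a (k + 1) - a k) * c := by nlinarith [h k]
        have h3 : c * (a k - c) ≤ a k * (a k - c) :=
          mul_le_mul_of_nonneg_right (by linarith) (by linarith)
        have h4 : a k - c ≤ a (k + 1) - a k := by
          refine le_of_mul_le_mul_right ?_ hc
          linarith
        linarith
  obtain ⟨k, hk⟩ := exists_nat_gt ((C - a 0) / (a 0 - c))
  rw [div_lt_iff₀ (by linarith)] at hk
  linarith [key k, hC k]

/-- Symmetry and Cauchy–Schwarz give `‖T_t u‖² = ⟨u, T_{2t} u⟩ ≤ ‖u‖ ‖T_{2t} u‖`. Iterated over the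
times `2 ^ k * t`, this forces the contraction, since the energy norms stay below the `L²` norm of
`(1 - L)^(1/2) u`. -/
theorem norm_semigroupF₁₂_le {t : ℝ} (ht : 0 < t) (u : S.F₁₂) : ‖S.semigroupF₁₂ t u‖ ≤ ‖u‖ := by
  refine le_of_sq_le_sq ?_ (norm_nonneg _)
  have hpos : ∀ k : ℕ, 0 < 2 ^ k * t := fun k => by positivity
  have := le_of_bounded_of_sq_le (a := fun k : ℕ => ‖S.semigroupF₁₂ (2 ^ k * t) u‖ ^ 2)
    (c := ‖u‖ ^ 2) (C := ‖S.sqrtOneSubL u‖ ^ 2) (sq_nonneg _) (fun k => ?_) (fun k => ?_)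
  · simpa using this
  · refine pow_le_pow_left₀ (norm_nonneg _) ((S.norm_F₁₂_le _).trans ?_) 2
    rw [sqrtOneSubL_semigroupF₁₂]
    exact S.contraction _ (hpos k) _
  · have e : ‖S.semigroupF₁₂ (2 ^ k * t) u‖ ^ 2 =
        inner ℝ u (S.semigroupF₁₂ (2 ^ (k + 1) * t) u) := by
      rw [← real_inner_self_eq_norm_sq, S.semigroupF₁₂_symmetric (hpos k),
        ← S.semigroupF₁₂_add (hpos k) (hpos k)]
      congr 2; ring_nf
    rw [← mul_pow, mul_comm ‖S.semigroupF₁₂ _ u‖ ‖u‖, e]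
    refine sq_le_sq' ?_ (real_inner_le_norm _ _)
    exact (abs_le.1 (abs_real_inner_le_norm _ _)).1

theorem tendsto_semigroupF₁₂ (u : S.F₁₂) :
    Tendsto (fun t => ‖S.semigroupF₁₂ t u - u‖) (𝓝[>] 0) (𝓝 0) := by
  have h := tendsto_iff_norm_sub_tendsto_zero.1 (S.strongly_continuous (S.sqrtOneSubL u))
  refine squeeze_zero (fun t => norm_nonneg _) (fun t => ?_) h
  refine (S.norm_F₁₂_le _).trans (le_of_eq ?_)
  rw [map_sub, sqrtOneSubL_semigroupF₁₂]

/-- The semigroup on the extended Dirichlet space. -/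
noncomputable def semigroupFe {t : ℝ} (ht : 0 < t) : S.Fe →L[ℝ] S.Fe :=
  ((S.semigroupF₁₂ t).mkContinuous 1 fun u => by
    rw [one_mul]; exact S.norm_semigroupF₁₂_le ht u).completion

@[simp]
theorem semigroupFe_coe {t : ℝ} (ht : 0 < t) (u : S.F₁₂) :
    S.semigroupFe ht (u : S.Fe) = (S.semigroupF₁₂ t u : S.Fe) :=
  UniformSpace.Completion.map_coe (ContinuousLinearMap.uniformContinuous _) u

theorem norm_semigroupFe_le {t : ℝ} (ht : 0 < t) (x : S.Fe) : ‖S.semigroupFe ht x‖ ≤ ‖x‖ := by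
  induction x using UniformSpace.Completion.induction_on with
  | hp => exact isClosed_le (by fun_prop) (by fun_prop)
  | ih u => simpa using S.norm_semigroupF₁₂_le ht u

theorem semigroupFe_symmetric {t : ℝ} (ht : 0 < t) (x y : S.Fe) :
    inner ℝ (S.semigroupFe ht x) y = inner ℝ x (S.semigroupFe ht y) := by
  induction x, y using UniformSpace.Completion.induction_on₂ with
  | hp => exact isClosed_eq (by fun_prop) (by fun_prop)
  | ih u v => simpa using S.semigroupF₁₂_symmetric ht u v

theorem exists_semigroupFe_close (x : S.Fe) {ε : ℝ} (hε : 0 < ε) :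
    ∀ᶠ t in 𝓝[>] (0 : ℝ), ∀ ht : 0 < t, ‖S.semigroupFe ht x - x‖ < ε := by
  obtain ⟨u, hu⟩ := Metric.denseRange_iff.1
    (UniformSpace.Completion.denseRange_coe (α := S.F₁₂)) x (ε / 3) (by positivity)
  rw [dist_eq_norm] at hu
  filter_upwards [(S.tendsto_semigroupF₁₂ u).eventually_lt_const (show 0 < ε / 3 by positivity)]
    with t h ht
  have h1 := (S.norm_semigroupFe_le ht (x - u)).trans_lt hu
  have h2 : ‖S.semigroupFe ht (u : S.Fe) - (u : S.Fe)‖ < ε / 3 := by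
    rw [semigroupFe_coe, ← UniformSpace.Completion.coe_sub, UniformSpace.Completion.norm_coe]
    exact h
  have e : S.semigroupFe ht x - x =
      S.semigroupFe ht (x - u) + (S.semigroupFe ht (u : S.Fe) - (u : S.Fe)) - (x - u) := by
    rw [map_sub]; abel
  rw [e]
  linarith [_root_.norm_sub_le (S.semigroupFe ht (x - u) + (S.semigroupFe ht (u : S.Fe) - (u : S.Fe))) (x - u),
    norm_add_le (S.semigroupFe ht (x - u)) (S.semigroupFe ht (u : S.Fe) - (u : S.Fe))]

/-- The dual semigroup is strongly continuous on `F_e^*`. -/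
theorem exists_dual_smoothing (ℓ : S.FeDual) : ∃ m : ℝ → S.FeDual,
    (∀ t, 0 < t → ∀ u : S.F₁₂, m t (u : S.Fe) = ℓ (S.semigroupF₁₂ t u : S.Fe)) ∧
      Tendsto m (𝓝[>] 0) (𝓝 ℓ) := by
  -- By symmetry, precomposing `ℓ` with the semigroup amounts to moving its Riesz vector `x`. The
  -- value `0` for `t ≤ 0` is invisible to `𝓝[>] 0`.
  set x := (InnerProductSpace.toDual ℝ S.Fe).symm ℓ with hx
  have hℓ : ℓ = InnerProductSpace.toDual ℝ S.Fe x := by simp [hx]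
  refine ⟨fun t => InnerProductSpace.toDual ℝ S.Fe
    (if ht : 0 < t then S.semigroupFe ht x else 0), fun t ht u => ?_, ?_⟩
  · simp only [dif_pos ht]
    rw [InnerProductSpace.toDual_apply_apply, semigroupFe_symmetric, semigroupFe_coe,
      hℓ, InnerProductSpace.toDual_apply_apply]
  · rw [hℓ]
    refine ((InnerProductSpace.toDual ℝ S.Fe).continuous.tendsto x).comp ?_
    rw [Metric.tendsto_nhds]
    intro ε hε
    filter_upwards [S.exists_semigroupFe_close x hε, self_mem_nhdsWithin] with t h ht
    rw [dif_pos (mem_Ioi.1 ht), dist_eq_norm]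
    exact h ht

end SubMarkovSemigroup

end DirichletSVI

/-! ### Extension of the semigroup to `L¹` and representation of functionals -/

namespace DirichletSVI

variable {E : Type*} [MeasurableSpace E] {μ : Measure E}

theorem lintegral_ofReal_comp_le_liminf {ψ : ℝ → ℝ} (hψ : Continuous ψ) {f : ℕ → E → ℝ}
    {g : E → ℝ} (hf : ∀ n, AEStronglyMeasurable (f n) μ)
    (h : ∀ᵐ x ∂μ, Tendsto (fun n => f n x) atTop (𝓝 (g x))) :
    ∫⁻ x, ENNReal.ofReal (ψ (g x)) ∂μ ≤
      liminf (fun n => ∫⁻ x, ENNReal.ofReal (ψ (f n x)) ∂μ) atTop := by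
  refine le_trans (le_of_eq ?_) (lintegral_liminf_le' fun n =>
    (hψ.comp_aestronglyMeasurable (hf n)).aemeasurable.ennreal_ofReal)
  refine lintegral_congr_ae ?_
  filter_upwards [h] with x hx
  exact (ENNReal.tendsto_ofReal ((hψ.tendsto _).comp hx)).liminf_eq.symm

theorem tendsto_integral_bdd_mul {h v : E → ℝ} (hh : MemLp h ∞ μ) {f : ℕ → E → ℝ}
    (hf : ∀ k, Integrable (f k) μ) (hv : Integrable v μ)
    (hfv : Tendsto (fun k => eLpNorm (f k - v) 1 μ) atTop (𝓝 0)) :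
    Tendsto (fun k => ∫ x, h x * f k x ∂μ) atTop (𝓝 (∫ x, h x * v x ∂μ)) := by
  obtain ⟨M, hM0, hM⟩ := ae_abs_le_of_memLp_top hh
  refine tendsto_integral_of_L1' _ (hh.1.mul hv.1)
    (.of_forall fun k => (hf k).bdd_mul hh.1 hM) ?_
  have hlim : Tendsto (fun k => ENNReal.ofReal M * eLpNorm (f k - v) 1 μ) atTop (𝓝 0) := by
    simpa using ENNReal.Tendsto.const_mul hfv (.inr ENNReal.ofReal_ne_top)
  refine tendsto_of_tendsto_of_tendsto_of_le_of_le tendsto_const_nhds hlim (fun _ => zero_le)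
    fun k => ?_
  refine eLpNorm_le_mul_eLpNorm_of_ae_le_mul ?_ 1
  filter_upwards [hM] with x hx
  rw [Pi.sub_apply, Pi.sub_apply, Pi.mul_apply, ← mul_sub, norm_mul]
  exact mul_le_mul_of_nonneg_right hx (norm_nonneg _)

theorem tendsto_eLpNorm_one_of_tendsto_L2 [IsFiniteMeasure μ] {ι : Type*} {l : Filter ι}
    {f : ι → Lp ℝ 2 μ} {g : Lp ℝ 2 μ} (h : Tendsto f l (𝓝 g)) :
    Tendsto (fun k => eLpNorm (⇑(f k) - ⇑g) 1 μ) l (𝓝 0) := by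
  have h2 := (Lp.tendsto_Lp_iff_tendsto_eLpNorm' f g).1 h
  have hC : μ univ ^ (1 / (1 : ℝ≥0∞).toReal - 1 / (2 : ℝ≥0∞).toReal) ≠ ∞ :=
    ENNReal.rpow_ne_top_of_nonneg (by norm_num) (measure_ne_top μ univ)
  refine tendsto_of_tendsto_of_tendsto_of_le_of_le tendsto_const_nhds
    (by simpa only [zero_mul] using ENNReal.Tendsto.mul_const h2 (.inr hC)) (fun _ => zero_le)
    fun k => eLpNorm_le_eLpNorm_mul_rpow_measure_univ (by norm_num)
      ((Lp.aestronglyMeasurable _).sub (Lp.aestronglyMeasurable _))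

theorem L2_bounded_approx [IsFiniteMeasure μ] (w : Lp ℝ 2 μ) :
    ∃ f : ℕ → Lp ℝ 2 μ, (∀ k, MemLp (f k) ∞ μ) ∧ Tendsto f atTop (𝓝 w) := by
  obtain ⟨f, hb, -, hf⟩ := exists_bounded_approx w
  exact ⟨f, hb, (Lp.tendsto_Lp_iff_tendsto_eLpNorm' f w).2 hf⟩

namespace SubMarkovSemigroup

variable (S : SubMarkovSemigroup μ)

theorem eLpNorm_two_P_le {t : ℝ} [IsFiniteMeasure μ] (f : Lp ℝ 2 μ) :
    eLpNorm (S.P t f) 2 μ ≤ S.norm12 t * eLpNorm f 1 μ := by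
  have hfin : eLpNorm f 1 μ ≠ ∞ :=
    ((Lp.memLp f).mono_exponent (by norm_num : (1 : ℝ≥0∞) ≤ 2)).2.ne
  rcases eq_or_ne (eLpNorm f 1 μ) 0 with h0 | h0
  · have : f = 0 := by
      refine Lp.ext ?_
      exact ((eLpNorm_eq_zero_iff (Lp.aestronglyMeasurable f) one_ne_zero).1 h0).trans
        (Lp.coeFn_zero ℝ 2 μ).symm
    rw [this, map_zero, eLpNorm_congr_ae (Lp.coeFn_zero ℝ 2 μ), eLpNorm_zero]
    exact zero_le
  · set N := (eLpNorm f 1 μ).toReal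
    have hN : 0 < N := ENNReal.toReal_pos h0 hfin
    have hNe : ‖N⁻¹‖ₑ = (eLpNorm f 1 μ)⁻¹ := by
      rw [Real.enorm_of_nonneg (inv_pos.2 hN).le, ENNReal.ofReal_inv_of_pos hN,
        ENNReal.ofReal_toReal hfin]
    have h1 : eLpNorm (N⁻¹ • f : Lp ℝ 2 μ) 1 μ ≤ 1 := by
      rw [eLpNorm_congr_ae (Lp.coeFn_smul _ _), eLpNorm_const_smul, hNe]
      exact (ENNReal.inv_mul_cancel h0 hfin).le
    have h2 : eLpNorm (S.P t (N⁻¹ • f)) 2 μ ≤ S.norm12 t :=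
      le_iSup₂_of_le (N⁻¹ • f) h1 le_rfl
    rw [map_smul, eLpNorm_congr_ae (Lp.coeFn_smul _ _), eLpNorm_const_smul, hNe] at h2
    rwa [ENNReal.inv_mul_le_iff h0 hfin, mul_comm] at h2

/-- `q ∈ L²(μ)` is the image of `v ∈ L¹(μ)` under the extension of `P_t` to `L¹(μ)`. -/
structure IsSmoothing (t : ℝ) (v : Lp ℝ 1 μ) (q : Lp ℝ 2 μ) : Prop where
  integral_eq : ∀ f : Lp ℝ 2 μ, MemLp f ∞ μ → ∫ x, S.P t f x * v x ∂μ = ∫ x, f x * q x ∂μ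
  lintegral_convex_le : ∀ ψ : ℝ → ℝ, (∀ r, 0 ≤ ψ r) → ConvexOn ℝ univ ψ → ψ 0 = 0 →
    ∫⁻ x, ENNReal.ofReal (ψ (q x)) ∂μ ≤ ∫⁻ x, ENNReal.ofReal (ψ (v x)) ∂μ
  eLpNorm_sub_le : ∀ f : Lp ℝ 2 μ, MemLp f ∞ μ →
    eLpNorm (⇑q - ⇑(S.P t f)) 1 μ ≤ eLpNorm (⇑v - ⇑f) 1 μ

variable [IsFiniteMeasure μ]

/-- For bounded truncations `f k → v` in `L¹`, finiteness of `norm12` makes `P_t (f k)` Cauchy in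
`L²`; `q` is its limit. -/
theorem exists_isSmoothing {t : ℝ} (ht : 0 < t) (hP : S.norm12 t < ∞) (v : Lp ℝ 1 μ) :
    ∃ q, S.IsSmoothing t v q := by
  obtain ⟨f, hb, hfv, hlim⟩ := exists_bounded_approx v
  have hm : ∀ g : Lp ℝ 2 μ, AEStronglyMeasurable g μ := Lp.aestronglyMeasurable
  have hmv := Lp.aestronglyMeasurable v
  have hcauchy : CauchySeq fun k => S.P t (f k) := by
    rw [Lp.cauchySeq_Lp_iff_cauchySeq_eLpNorm]
    have h1 : Tendsto (fun n : ℕ × ℕ => S.norm12 t *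
        (eLpNorm (⇑(f n.1) - ⇑v) 1 μ + eLpNorm (⇑(f n.2) - ⇑v) 1 μ)) atTop (𝓝 0) := by
      rw [← prod_atTop_atTop_eq]
      simpa using ENNReal.Tendsto.const_mul
        ((hlim.comp tendsto_fst).add (hlim.comp tendsto_snd)) (.inr hP.ne)
    refine tendsto_of_tendsto_of_tendsto_of_le_of_le tendsto_const_nhds h1 (fun _ => zero_le)
      fun n => ?_
    rw [← eLpNorm_congr_ae (Lp.coeFn_sub _ _), ← map_sub]
    refine (S.eLpNorm_two_P_le _).trans (mul_le_mul_right ?_ _)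
    rw [eLpNorm_congr_ae (Lp.coeFn_sub _ _)]
    have e : ⇑(f n.1) - ⇑(f n.2) = (⇑(f n.1) - ⇑v) - (⇑(f n.2) - ⇑v) := by abel
    rw [e]
    exact eLpNorm_sub_le ((hm _).sub hmv) ((hm _).sub hmv) le_rfl
  obtain ⟨q, hq⟩ := cauchySeq_tendsto_of_complete hcauchy
  refine ⟨q, fun g hg => ?_, fun ψ h0 hc hz => ?_, fun g hg => ?_⟩
  · have h1 := tendsto_integral_bdd_mul (S.P_memLp_top ht hg)
      (fun k => (Lp.memLp (f k)).integrable (by norm_num)) ((Lp.memLp v).integrable le_rfl) hlim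
    have h2 : Tendsto (fun k => inner ℝ g (S.P t (f k))) atTop (𝓝 (inner ℝ g q)) :=
      Tendsto.inner tendsto_const_nhds hq
    rw [← L2_inner_eq_integral]
    refine tendsto_nhds_unique h1 (h2.congr fun k => ?_)
    rw [← S.symmetric t ht, L2_inner_eq_integral]
  · have hcont : Continuous ψ := by rw [← continuousOn_univ]; exact hc.continuousOn isOpen_univ
    obtain ⟨ns, -, hns⟩ := (tendstoInMeasure_of_tendsto_Lp hq).exists_seq_tendsto_ae
    refine (lintegral_ofReal_comp_le_liminf hcont (fun n => hm _) hns).trans ?_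
    refine liminf_le_of_frequently_le' (.of_forall fun n => ?_)
    refine (S.lintegral_convex_P_le h0 hc hz ht (hb _)).trans (lintegral_mono_ae ?_)
    -- A truncation takes the value `0` or `v x`, so `ψ 0 = 0` gives `ψ (f k) ≤ ψ v`.
    filter_upwards [hfv (ns n)] with x hx
    rcases hx with hx | hx <;> simp [hx, hz]
  · have h1 := tendsto_eLpNorm_one_of_tendsto_L2 hq
    have h2 : Tendsto (fun k => eLpNorm (⇑(S.P t (f k)) - ⇑q) 1 μ +
        (eLpNorm (⇑(f k) - ⇑v) 1 μ + eLpNorm (⇑v - ⇑g) 1 μ)) atTop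
        (𝓝 (eLpNorm (⇑v - ⇑g) 1 μ)) := by
      simpa using h1.add (hlim.add_const _)
    refine ge_of_tendsto' h2 fun k => ?_
    have e : ⇑q - ⇑(S.P t g) = (⇑(S.P t (f k)) - ⇑(S.P t g)) - (⇑(S.P t (f k)) - ⇑q) := by abel
    rw [e]
    refine (eLpNorm_sub_le ((hm _).sub (hm _)) ((hm _).sub (hm _)) le_rfl).trans ?_
    rw [add_comm]
    refine add_le_add_right ?_ _
    rw [← eLpNorm_congr_ae (Lp.coeFn_sub _ _), ← map_sub]
    have hbd : MemLp (f k - g : Lp ℝ 2 μ) ∞ μ := ((hb k).sub hg).ae_eq (Lp.coeFn_sub _ _).symm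
    refine (S.eLpNorm_one_P_le ht hbd).trans ?_
    rw [eLpNorm_congr_ae (Lp.coeFn_sub _ _)]
    have e : ⇑(f k) - ⇑g = (⇑(f k) - ⇑v) + (⇑v - ⇑g) := by abel
    rw [e]
    exact eLpNorm_add_le ((hm _).sub hmv) (hmv.sub (hm _)) le_rfl

/-- An `ε/3` argument: strong continuity on a bounded approximant, and `L¹` contractivity for the
error. -/
theorem tendsto_eLpNorm_smoothing {v : Lp ℝ 1 μ} {t : ℕ → ℝ} (ht : Tendsto t atTop (𝓝[>] 0))
    {q : ℕ → Lp ℝ 2 μ} (hq : ∀ n, S.IsSmoothing (t n) v (q n)) :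
    Tendsto (fun n => eLpNorm (⇑(q n) - ⇑v) 1 μ) atTop (𝓝 0) := by
  obtain ⟨f, hb, -, hlim⟩ := exists_bounded_approx v
  have hm : ∀ g : Lp ℝ 2 μ, AEStronglyMeasurable g μ := Lp.aestronglyMeasurable
  have hmv := Lp.aestronglyMeasurable v
  rw [ENNReal.tendsto_nhds_zero]
  intro ε hε
  have hε3 : 0 < ε / 3 := ENNReal.div_pos hε.ne' (by norm_num)
  obtain ⟨k, hk⟩ := ((ENNReal.tendsto_nhds_zero.1 hlim) _ hε3).exists
  have h2 := tendsto_eLpNorm_one_of_tendsto_L2 ((S.strongly_continuous (f k)).comp ht)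
  filter_upwards [(ENNReal.tendsto_nhds_zero.1 h2) _ hε3] with n hn
  have h3 := (hq n).eLpNorm_sub_le (f k) (hb k)
  have e : ⇑(q n) - ⇑v = (⇑(q n) - ⇑(S.P (t n) (f k))) +
      ((⇑(S.P (t n) (f k)) - ⇑(f k)) + (⇑(f k) - ⇑v)) := by abel
  rw [e]
  refine (eLpNorm_add_le ((hm _).sub (hm _)) (((hm _).sub (hm _)).add ((hm _).sub hmv))
    le_rfl).trans ?_
  rw [eLpNorm_sub_comm ⇑v] at h3
  rw [← ENNReal.add_thirds ε, add_assoc]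
  exact add_le_add (h3.trans hk) ((eLpNorm_add_le ((hm _).sub (hm _)) ((hm _).sub hmv)
    le_rfl).trans (add_le_add hn hk))

theorem exists_tendsto_nhdsGT_zero : ∃ t : ℕ → ℝ, (∀ n, 0 < t n) ∧ Tendsto t atTop (𝓝[>] 0) :=
  ⟨fun n => 1 / ((n : ℝ) + 1), fun n => by positivity,
    tendsto_nhdsWithin_iff.2 ⟨tendsto_one_div_add_atTop_nhds_zero_nat,
      .of_forall fun n => mem_Ioi.2 (by positivity)⟩⟩

/-- Testing with `P_t V₁ f` for bounded `f` gives `⟨f, V₁ q⟩ = 0`, where `q` is the smoothing of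
`z`. Thus `V₁ q = 0`, so `q = 0` by injectivity, and `q → z` in `L¹` as `t → 0`. -/
theorem eq_zero_of_integral_F₁₂_eq_zero (hP : ∀ t, 0 < t → S.norm12 t < ∞) {z : Lp ℝ 1 μ}
    (hz : ∀ u : S.F₁₂, MemLp (S.toL2 u) ∞ μ → ∫ x, S.toL2 u x * z x ∂μ = 0) : z = 0 := by
  obtain ⟨t, ht0, ht⟩ := exists_tendsto_nhdsGT_zero
  choose q hq using fun n => S.exists_isSmoothing (ht0 n) (hP _ (ht0 n)) z
  have hq0 : ∀ n, q n = 0 := by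
    intro n
    have horth : ∀ f : Lp ℝ 2 μ, MemLp f ∞ μ → inner ℝ f (S.V₁ (q n)) = 0 := fun f hf => by
      rw [← V₁_symmetric, L2_inner_eq_integral,
        ← (hq n).integral_eq _ (S.V₁_memLp_top hf), S.P_V₁ (ht0 n), ← toL2_sqrtOneSubL_symm]
      refine hz _ ?_
      rw [toL2_sqrtOneSubL_symm]
      exact S.V₁_memLp_top (S.P_memLp_top (ht0 n) hf)
    obtain ⟨f, hb, hf⟩ := L2_bounded_approx (S.V₁ (q n))
    have h1 : Tendsto (fun k => inner ℝ (f k) (S.V₁ (q n))) atTop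
        (𝓝 (inner ℝ (S.V₁ (q n)) (S.V₁ (q n)))) := hf.inner tendsto_const_nhds
    have h2 := tendsto_nhds_unique h1 (tendsto_const_nhds.congr fun k => (horth _ (hb k)).symm)
    exact S.V₁_injective ((inner_self_eq_zero.1 h2).trans (map_zero _).symm)
  have h := S.tendsto_eLpNorm_smoothing ht hq
  have hc : ∀ n, eLpNorm (⇑(q n) - ⇑z) 1 μ = eLpNorm z 1 μ := fun n => by
    rw [hq0 n, ← eLpNorm_neg (f := ⇑z)]
    refine eLpNorm_congr_ae ?_
    filter_upwards [Lp.coeFn_zero ℝ 2 μ] with x hx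
    simp only [Pi.sub_apply, Pi.neg_apply]
    rw [hx]; simp
  simp_rw [hc] at h
  have h0 := tendsto_nhds_unique tendsto_const_nhds h
  rw [eLpNorm_eq_zero_iff (Lp.aestronglyMeasurable z) one_ne_zero] at h0
  exact Lp.ext (h0.trans (Lp.coeFn_zero ℝ 1 μ).symm)

theorem integrable_bdd_mul {h : E → ℝ} (hh : MemLp h ∞ μ) (v : Lp ℝ 1 μ) :
    Integrable (fun x => h x * v x) μ := by
  obtain ⟨M, -, hM⟩ := ae_abs_le_of_memLp_top hh
  exact ((Lp.memLp v).integrable le_rfl).bdd_mul hh.1 hM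

variable {S}

theorem RepresentsL1.unique (hP : ∀ t, 0 < t → S.norm12 t < ∞) {ℓ : S.FeDual} {v v' : Lp ℝ 1 μ}
    (h : S.RepresentsL1 ℓ v) (h' : S.RepresentsL1 ℓ v') : v = v' := by
  refine sub_eq_zero.1 (S.eq_zero_of_integral_F₁₂_eq_zero hP fun u hu => ?_)
  have e : ∫ x, S.toL2 u x * (v - v' : Lp ℝ 1 μ) x ∂μ =
      ∫ x, (S.toL2 u x * v x - S.toL2 u x * v' x) ∂μ := by
    refine integral_congr_ae ?_
    filter_upwards [Lp.coeFn_sub v v'] with x hx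
    rw [hx, Pi.sub_apply, mul_sub]
  rw [e, integral_sub (integrable_bdd_mul hu v) (integrable_bdd_mul hu v'), ← h u hu, ← h' u hu,
    sub_self]

theorem RepresentsL1.phi_eq (hP : ∀ t, 0 < t → S.norm12 t < ∞) {ℓ : S.FeDual} {v : Lp ℝ 1 μ}
    (h : S.RepresentsL1 ℓ v) (ψ : ℝ → ℝ) :
    S.phi ψ ℓ = ∫⁻ x, ENNReal.ofReal (ψ (v x)) ∂μ :=
  le_antisymm (iInf₂_le v h) (le_iInf₂ fun v' h' => by rw [h.unique hP h'])

/-- If `ℓ` is represented by `v ∈ L¹(μ)`, then `ℓ ∘ P_t` is represented by `P_t v ∈ L²(μ)`. -/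
theorem RepresentsL1.representsL2 {ℓ m : S.FeDual} {v : Lp ℝ 1 μ} (h : S.RepresentsL1 ℓ v)
    {t : ℝ} (ht : 0 < t) (hm : ∀ u : S.F₁₂, m (u : S.Fe) = ℓ (S.semigroupF₁₂ t u : S.Fe))
    {q : Lp ℝ 2 μ} (hq : S.IsSmoothing t v q) : S.RepresentsL2 m q := by
  have hbdd : ∀ u : S.F₁₂, MemLp (S.toL2 u) ∞ μ → m (u : S.Fe) = inner ℝ (S.toL2 u) q :=
    fun u hu => by
      rw [hm, h _ (by rw [S.toL2_semigroupF₁₂ ht]; exact S.P_memLp_top ht hu),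
        S.toL2_semigroupF₁₂ ht, hq.integral_eq _ hu, L2_inner_eq_integral]
  intro u
  rw [← L2_inner_eq_integral]
  -- The formula is known for bounded `u` only. Approximating `(1 - L)^(1/2) u` by bounded `w k`
  -- gives bounded `V₁ (w k)` converging to `u` both in energy and in `L²`.
  obtain ⟨w, hb, hw⟩ := L2_bounded_approx (S.sqrtOneSubL u)
  have hw0 := tendsto_iff_norm_sub_tendsto_zero.1 hw
  have h1 : Tendsto (fun k => (S.sqrtOneSubL.symm (w k) : S.F₁₂)) atTop (𝓝 u) := by
    rw [tendsto_iff_norm_sub_tendsto_zero]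
    refine squeeze_zero (fun _ => norm_nonneg _) (fun k => ?_) hw0
    refine (S.norm_F₁₂_le _).trans (le_of_eq ?_)
    rw [map_sub, LinearEquiv.apply_symm_apply]
  have h2 : Tendsto (fun k => S.toL2 (S.sqrtOneSubL.symm (w k))) atTop (𝓝 (S.toL2 u)) := by
    rw [tendsto_iff_norm_sub_tendsto_zero]
    refine squeeze_zero (fun _ => norm_nonneg _) (fun k => ?_) hw0
    rw [← map_sub, ← V₁_sqrtOneSubL, map_sub, LinearEquiv.apply_symm_apply]
    exact S.norm_V₁_le _
  have h3 := (m.continuous.tendsto _).comp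
    (((UniformSpace.Completion.continuous_coe _).tendsto u).comp h1)
  refine tendsto_nhds_unique h3 ((h2.inner tendsto_const_nhds).congr fun k => ?_)
  exact (hbdd _ (by rw [toL2_sqrtOneSubL_symm]; exact S.V₁_memLp_top (hb k))).symm

end SubMarkovSemigroup

end DirichletSVI

/-! ### The approximation theorem -/

theorem proposition5p3 {E : Type*} [MeasurableSpace E] [StandardBorelSpace E]
    (μ : Measure E) [IsFiniteMeasure μ]
    (S : DirichletSVI.SubMarkovSemigroup μ)
    (hT : S.Transient)
    (ψ : ℝ → ℝ)
    (hψ_nonneg : ∀ r, 0 ≤ ψ r) (hψ_convex : ConvexOn ℝ Set.univ ψ)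
    (hψ_lsc : LowerSemicontinuous ψ) (hψ_zero : ψ 0 = 0)
    (hψ_superlinear : Tendsto (fun r : ℝ => ψ r / |r|) (cocompact ℝ) atTop)
    (hP : ∀ t : ℝ, 0 < t → S.norm12 t < ∞)
    (v : S.FeDual) (hv : S.phi ψ v < ∞) :
    ∃ w : ℕ → S.FeDual,
      (∀ n, w n ∈ S.L2capFeDual) ∧
      Tendsto (fun n => toWeakSpace ℝ S.FeDual (w n)) atTop (𝓝 (toWeakSpace ℝ S.FeDual v)) ∧
      Tendsto (fun n => S.phi ψ (w n)) atTop (𝓝 (S.phi ψ v)) := by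
  obtain ⟨f, hf⟩ : ∃ f, S.RepresentsL1 v f := by
    obtain ⟨f, hf⟩ := iInf_lt_iff.1 hv
    obtain ⟨hf, -⟩ := iInf_lt_iff.1 hf
    exact ⟨f, hf⟩
  have hcont : Continuous ψ := by
    rw [← continuousOn_univ]; exact hψ_convex.continuousOn isOpen_univ
  obtain ⟨t, ht0, ht⟩ := DirichletSVI.SubMarkovSemigroup.exists_tendsto_nhdsGT_zero
  choose q hq using fun n => S.exists_isSmoothing (ht0 n) (hP _ (ht0 n)) f
  -- Fatou needs a.e. convergence, hence the passage to a subsequence.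
  obtain ⟨ns, hns, hae⟩ := (tendstoInMeasure_of_tendsto_eLpNorm one_ne_zero
    (fun n => Lp.aestronglyMeasurable (q n)) (Lp.aestronglyMeasurable f)
    (S.tendsto_eLpNorm_smoothing ht hq)).exists_seq_tendsto_ae
  obtain ⟨m, hm, hmlim⟩ := S.exists_dual_smoothing v
  have hrep : ∀ n, S.RepresentsL2 (m (t n)) (q n) := fun n =>
    hf.representsL2 (ht0 n) (hm _ (ht0 n)) (hq n)
  have hphi : ∀ n, S.phi ψ (m (t n)) = ∫⁻ x, ENNReal.ofReal (ψ (q n x)) ∂μ := fun n => by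
    -- `phi` sees only `L¹` representatives; `q n` is one because `μ` is finite.
    have h1 : MemLp (q n) 1 μ := (Lp.memLp (q n)).mono_exponent (by norm_num)
    have hr : S.RepresentsL1 (m (t n)) (h1.toLp _) := fun u _ => by
      rw [hrep n u]
      refine integral_congr_ae ?_
      filter_upwards [h1.coeFn_toLp] with x hx
      rw [hx]
    rw [hr.phi_eq hP]
    refine lintegral_congr_ae ?_
    filter_upwards [h1.coeFn_toLp] with x hx
    rw [hx]
  refine ⟨fun n => m (t (ns n)), fun n => ⟨_, hrep _⟩, ?_, ?_⟩
  · exact ((toWeakSpaceCLM ℝ S.FeDual).continuous.tendsto v).comp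
      (hmlim.comp (ht.comp hns.tendsto_atTop))
  · simp_rw [hphi, hf.phi_eq hP]
    refine tendsto_of_le_liminf_of_limsup_le
      (DirichletSVI.lintegral_ofReal_comp_le_liminf hcont
        (fun n => Lp.aestronglyMeasurable (q (ns n))) hae) ?_
    refine limsup_le_of_le (h := .of_forall fun n => ?_)
    exact (hq _).lintegral_convex_le ψ hψ_nonneg hψ_convex hψ_zero
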